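/- Let $m\ge 0$, let $X=\{x_0,x_1,\dots,x_m\}$ be an alphabet of noncommuting letters, let $X^*$ be the set of words over $X$ with empty word $\emptyset$, and let $|\eta|_{x_j}$ be the number of occurrences of $x_j$ in $\eta$. Let $\mathbb R\langle\langle X\rangle\rangle$ be the set of formal series $c=\sum_{\eta\in X^*}(c,\eta)\,\eta$ with $(c,\eta)\in\mathbb R$, and let $\mathbb R^m\langle\langle X\rangle\rangle$ be the set of $m$-tuples $c=(c_1,\dots,c_m)$ of such series. Write $\sqcup\!\sqcup$ for the shuffle product. For $d\in\mathbb R^m\langle\langle X\rangle\rangle$ put $d_0:=0$, $\phi_d(x_i)(e):=x_ie+x_0(d_i\sqcup\!\sqcup e)$ for $e\in\mathbb R\langle\langle X\rangle\rangle$, $\phi_d(x_{i_1}\cdots x_{i_k}):=\phi_d(x_{i_1})\circ\cdots\circ\phi_d(x_{i_k})$ and $\phi_d(\emptyset):=\mathrm{id}$. For $c,d\in\mathbb R^m\langle\langle X\rangle\rangle$ let $$(c\,\tilde\circ\, d)_i:=\sum_{\eta\in X^*}(c_i,\eta)\,\phi_d(\eta)(1),\qquad c\circledcirc d:=d+c\,\tilde\circ\,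 d .$$ Let $H$ be the free commutative unital $\mathbb R$-algebra, with product $\mu$ and unit $\mathbf 1$, on the coordinate maps $a^i_\eta: c\mapsto (c_i,\eta)$, $1\le i\le m$, $\eta\in X^*$. Elements of $H$ are evaluated at $c\in\mathbb R^m\langle\langle X\rangle\rangle$, and elements of $H\otimes H$ at pairs $(c,d)$ by $(a\otimes b)(c,d)=a(c)\,b(d)$. Let $H_n$ be the span of the monomials $a^{i_1}_{\eta_1}\cdots a^{i_r}_{\eta_r}$ of total degree $n$, where $\deg a^i_\eta=2|\eta|_{x_0}+\sum_{j=1}^m|\eta|_{x_j}+1$. **Theorem.** There is exactly one algebra morphism $\Delta:H\to H\otimes H$ such that $$(\Delta a^i_\eta)(c,d)=((c\circledcirc d)_i,\eta)\qquad\text{for all } i,\ \eta,\ \text{and all } c,d\in\mathbb R^m\langle\langle X\rangle\rangle .$$ With this coproduct, and with the counit $\varepsilon$ given by the algebra morphism $\varepsilon(a^i_\eta)=0$, $(H,\mu,\Delta)$ is a connected graded commutative unital Hopf algebra. That is: $\Delta$ is coassociative and $\varepsilon$ is a counit for it; $H=\bigoplus_{n\ge0}H_n$ with $H_kH_l\subseteq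 H_{k+l}$, $H_0=\mathbb R\mathbf 1$, $\Delta H_n\subseteq\bigoplus_{k+l=n}H_k\otimes H_l$ and $\varepsilon(H_n)=0$ for $n>0$; and there is an antipode $S:H\to H$, that is, a linear map with $\mu\circ(S\otimes\mathrm{id})\circ\Delta=\mu\circ(\mathrm{id}\otimes S)\circ\Delta=\varepsilon(\cdot)\mathbf 1$, which moreover satisfies $S(xy)=S(y)S(x)$ and $S(H_n)\subseteq H_n$. -/

import Mathlib

open scoped TensorProduct

noncomputable section

namespace OutputFeedback

/-- Words over the alphabet `x_0, x_1, …, x_m`; the letter `x_i` is `i : Fin (m + 1)`. -/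
abbrev Word (m : ℕ) := List (Fin (m + 1))

/-- Formal power series in `x_0, …, x_m` with real coefficients: `c η` is `(c, η)`. -/
abbrev Series (m : ℕ) := Word m → ℝ

/-- Series with coefficients in `ℝ^m`, given by their `m` component series; the component `c_j`,
`1 ≤ j ≤ m`, has index `j - 1 : Fin m` and corresponds to the letter `(j - 1).succ`. -/
abbrev VSeries (m : ℕ) := Fin m → Series m

/-- The shuffle product of two words, as the multiset of the words that occur in it. -/
def shuffleWord {m : ℕ} : Word m → Word m → Multiset (Word m)
  | [], ξ => {ξ}
  | i :: η, [] => {i :: η}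
  | i :: η, j :: ξ =>
      (shuffleWord η (j :: ξ)).map (i :: ·) + (shuffleWord (i :: η) ξ).map (j :: ·)
termination_by η ξ => η.length + ξ.length

/-- The shuffle product of two series, `∑_{η, ξ} (c, η) (d, ξ) η ⧢ ξ`. -/
def shuffle {m : ℕ} (c d : Series m) : Series m := fun ζ =>
  ∑ᶠ p : Word m × Word m, c p.1 * d p.2 * ((shuffleWord p.1 p.2).count ζ : ℝ)

/-- The series `x_i e`. -/
def letterMul {m : ℕ} (i : Fin (m + 1)) (e : Series m) : Series m
  | [] => 0
  | j :: η => if j = i then e η else 0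

/-- The series `1`. -/
def oneSeries (m : ℕ) : Series m
  | [] => 1
  | _ :: _ => 0

/-- `φ_d(x_i)(e) = x_i e + x_0 (d_i ⧢ e)`, where `d_0 = 0`. -/
def phiLetter {m : ℕ} (d : VSeries m) (i : Fin (m + 1)) (e : Series m) : Series m :=
  letterMul i e + letterMul 0 (shuffle (Fin.cases 0 d i) e)

/-- `φ_d(x_{i_1} ⋯ x_{i_k}) = φ_d(x_{i_1}) ∘ ⋯ ∘ φ_d(x_{i_k})`. -/
def phi {m : ℕ} (d : VSeries m) : Word m → Series m → Series m
  | [], e => e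
  | i :: η, e => phiLetter d i (phi d η e)

/-- The modified composition product `∑_η (c, η) φ_d(η)(1)` of a scalar series `c` with `d`. -/
def modComp {m : ℕ} (c : Series m) (d : VSeries m) : Series m := fun ξ =>
  ∑ᶠ η : Word m, c η * phi d η (oneSeries m) ξ

/-- The product `c ⊚ d = d + c ∘̃ d` of the output feedback group. -/
def feedbackProd {m : ℕ} (c d : VSeries m) : VSeries m := fun i => d i + modComp (c i) d

/-- The free commutative unital algebra on the coordinate maps `a^i_η`. -/
abbrev H (m : ℕ) := MvPolynomial (Fin m × Word m) ℝ

/-- The coordinate map `a^i_η` as a generator of `H`. -/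
def coord {m : ℕ} (i : Fin m) (η : Word m) : H m := MvPolynomial.X (i, η)

/-- Evaluation of the elements of `H` at a series `c`: it sends `a^i_η` to `(c_i, η)`. -/
def evalAt {m : ℕ} (c : VSeries m) : H m →ₐ[ℝ] ℝ := MvPolynomial.aeval fun p => c p.1 p.2

/-- Evaluation of the elements of `H ⊗ H` at a pair of series: `(a ⊗ b)(c, d) = a(c) b(d)`. -/
def evalPair {m : ℕ} (c d : VSeries m) : H m ⊗[ℝ] H m →ₐ[ℝ] ℝ :=
  Algebra.TensorProduct.productMap (evalAt c) (evalAt d)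

/-- `Δ` is an algebra morphism dual to the group product: `(Δ a^i_η)(c, d) = ((c ⊚ d)_i, η)`. -/
def IsDualCoproduct {m : ℕ} (Δ : H m →ₐ[ℝ] H m ⊗[ℝ] H m) : Prop :=
  ∀ (i : Fin m) (η : Word m) (c d : VSeries m),
    evalPair c d (Δ (coord i η)) = feedbackProd c d i η

/-- The counit: `ε(a^i_η) = 0`, `ε(1) = 1`. -/
def counit (m : ℕ) : H m →ₐ[ℝ] ℝ := MvPolynomial.aeval fun _ => 0

/-- `deg a^i_η = 2 |η|_{x_0} + ∑_{j = 1}^m |η|_{x_j} + 1`. -/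
def deg {m : ℕ} (p : Fin m × Word m) : ℕ :=
  2 * p.2.count 0 + ∑ j : Fin m, p.2.count j.succ + 1

/-- `H_n`, the elements of `H` of degree `n`. -/
def grading (m : ℕ) (n : ℕ) : Submodule ℝ (H m) :=
  MvPolynomial.weightedHomogeneousSubmodule ℝ deg n

/-- `(A ⊗ A)_n = ∑_{k + l = n} A_k ⊗ A_l` inside `A ⊗ A`. -/
def tensorGrading {A : Type*} [CommRing A] [Algebra ℝ A] (𝒜 : ℕ → Submodule ℝ A) (n : ℕ) :
    Submodule ℝ (A ⊗[ℝ] A) :=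
  ⨆ p ∈ Finset.HasAntidiagonal.antidiagonal n,
    LinearMap.range (TensorProduct.map (𝒜 p.1).subtype (𝒜 p.2).subtype)

/-- The commutative unital algebra `A`, with its subspaces `𝒜 n` and with the algebra morphisms
`Δ` and `ε` as coproduct and counit, is a connected graded Hopf algebra. -/
structure IsConnectedGradedHopfAlgebra {A : Type*} [CommRing A] [Algebra ℝ A]
    (𝒜 : ℕ → Submodule ℝ A) (Δ : A →ₐ[ℝ] A ⊗[ℝ] A) (ε : A →ₐ[ℝ] ℝ) : Prop where
  coassoc : (Algebra.TensorProduct.assoc ℝ ℝ ℝ A A A).toAlgHom.comp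
      ((Algebra.TensorProduct.map Δ (.id ℝ A)).comp Δ)
      = (Algebra.TensorProduct.map (.id ℝ A) Δ).comp Δ
  counit_left : (Algebra.TensorProduct.map ε (.id ℝ A)).comp Δ
      = (Algebra.TensorProduct.lid ℝ A).symm
  counit_right : (Algebra.TensorProduct.map (.id ℝ A) ε).comp Δ
      = (Algebra.TensorProduct.rid ℝ ℝ A).symm
  /-- `A` is the direct sum of the `A_n`. -/
  isInternal : DirectSum.IsInternal 𝒜
  /-- `1 ∈ A_0` and `A_k A_l ⊆ A_{k+l}`. -/
  gradedMonoid : SetLike.GradedMonoid 𝒜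
  /-- `A_0 = ℝ 1`. -/
  connected : 𝒜 0 = Submodule.span ℝ {1}
  /-- `Δ A_n ⊆ (A ⊗ A)_n`. -/
  comul_mem : ∀ n, ∀ a ∈ 𝒜 n, Δ a ∈ tensorGrading 𝒜 n
  /-- `ε` vanishes on `A_n` for `n > 0`. -/
  counit_eq_zero : ∀ n, 0 < n → ∀ a ∈ 𝒜 n, ε a = 0
  /-- The bialgebra has an antipode, antimultiplicative and of degree zero. -/
  exists_antipode : ∃ h : HopfAlgebra ℝ A,
    h.toBialgebra = Bialgebra.ofAlgHom Δ ε coassoc counit_left counit_right ∧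
    (∀ a b, h.antipode (a * b) = h.antipode b * h.antipode a) ∧
    ∀ n, ∀ a ∈ 𝒜 n, h.antipode a ∈ 𝒜 n

/-! The sums that define the two products have only finitely many nonzero terms. -/

theorem length_of_mem_shuffleWord {m : ℕ} (η ξ ζ : Word m) (h : ζ ∈ shuffleWord η ξ) :
    ζ.length = η.length + ξ.length := by
  fun_induction shuffleWord η ξ generalizing ζ with
  | case1 ξ => simp_all
  | case2 i η => simp_all
  | case3 i η j ξ ih1 ih2 =>
    simp only [Multiset.mem_add, Multiset.mem_map] at h
    rcases h with ⟨ζ', h, rfl⟩ | ⟨ζ', h, rfl⟩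
    · have := ih1 ζ' h
      simp only [List.length_cons] at *
      omega
    · have := ih2 ζ' h
      simp only [List.length_cons] at *
      omega

theorem finite_words_length_le (m n : ℕ) : {η : Word m | η.length ≤ n}.Finite :=
  List.finite_length_le _ n

theorem shuffle_finite_support {m : ℕ} (c d : Series m) (ζ : Word m) :
    (Function.support fun p : Word m × Word m =>
      c p.1 * d p.2 * ((shuffleWord p.1 p.2).count ζ : ℝ)).Finite := by
  refine ((finite_words_length_le m ζ.length).prod
    (finite_words_length_le m ζ.length)).subset ?_
  rintro ⟨η, ξ⟩ hp
  have hc : (shuffleWord η ξ).count ζ ≠ 0 := by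
    intro h0
    simp [h0] at hp
  have := length_of_mem_shuffleWord η ξ ζ (Multiset.count_ne_zero.mp hc)
  simp only [Set.mem_prod, Set.mem_ofPred_eq]
  omega

theorem shuffle_eq_zero {m : ℕ} (c e : Series m) (n : ℕ) (he : ∀ ξ : Word m, ξ.length < n → e ξ = 0)
    (ζ : Word m) (hζ : ζ.length < n) : shuffle c e ζ = 0 := by
  unfold shuffle
  rw [← finsum_zero (α := Word m × Word m)]
  refine finsum_congr fun p => ?_
  by_cases hc : ζ ∈ shuffleWord p.1 p.2
  · have := length_of_mem_shuffleWord _ _ _ hc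
    rw [he p.2 (by omega)]
    simp
  · simp [Multiset.count_eq_zero_of_notMem hc]

theorem phi_eq_zero {m : ℕ} (d : VSeries m) (η ξ : Word m) (h : ξ.length < η.length) :
    phi d η (oneSeries m) ξ = 0 := by
  induction η generalizing ξ with
  | nil => simp at h
  | cons i η ih =>
    cases ξ with
    | nil => simp [phi, phiLetter, letterMul]
    | cons j ξ =>
      have h' : ξ.length < η.length := by simpa using h
      simp [phi, phiLetter, letterMul, ih ξ h', shuffle_eq_zero _ _ _ ih ξ h']

theorem modComp_finite_support {m : ℕ} (c : Series m) (d : VSeries m) (ξ : Word m) :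
    (Function.support fun η : Word m => c η * phi d η (oneSeries m) ξ).Finite := by
  refine (finite_words_length_le m ξ.length).subset fun η hη => ?_
  by_contra hlt
  simp only [Set.mem_ofPred_eq, not_le] at hlt
  simp [phi_eq_zero d η ξ hlt] at hη

end OutputFeedback

end

open scoped TensorProduct

noncomputable section

/-! `H` is the coordinate ring of a group: an algebra morphism from `H` to a commutative ring `B` is
an arbitrary `m`-tuple of series over `B`. So the feedback product is built over every commutative
ring (`gprod`), shown to be a group law natural in the ring (`map_gprod`), and the Hopf axioms are
read off at universal series: the coproduct is the product of the two universal series over `H ⊗ H`,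
the antipode the inverse of the one over `H`.

The group law rests on a recursion in the first letter (`comp_cons`): `∂_j` with `j ≥ 1` commutes
with `∘̃ d`, while `∂_0` picks up the correction `∑ d_i ⧢ (∂_i c ∘̃ d)`. Induction on words then
makes `∘̃ e` a shuffle morphism (`comp_shuf`), whence `comp_comp` and associativity; solving the
recursion for `c` gives inverses.

The grading works because `x_0` has weight 2: replacing `x_i` by `x_0 d_i` preserves degree when
`d_i` has degree one more than the weight of the word. Uniqueness of the coproduct holds because
real polynomials are determined by their values. -/

namespace OutputFeedback

/-! ### Shuffle and composition over a commutative ring, by left derivatives -/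

section Coefficients

variable {m : ℕ} {A B : Type*} [CommRing A] [CommRing B]

/-- The series `∂_i c` with `c = (c, ∅) + ∑_i x_i ∂_i c`. -/
def leftDeriv (i : Fin (m + 1)) (c : Word m → A) : Word m → A := fun η => c (i :: η)

/-- The shuffle product of series with coefficients in `A`, defined by the Leibniz rule. -/
def shuf : (Word m → A) → (Word m → A) → Word m → A
  | c, d, [] => c [] * d []
  | c, d, i :: ζ => shuf (leftDeriv i c) d ζ + shuf c (leftDeriv i d) ζ

theorem leftDeriv_add (i : Fin (m + 1)) (c d : Word m → A) :
    leftDeriv i (c + d) = leftDeriv i c + leftDeriv i d := rfl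

theorem leftDeriv_shuf (i : Fin (m + 1)) (c d : Word m → A) :
    leftDeriv i (shuf c d) = shuf (leftDeriv i c) d + shuf c (leftDeriv i d) := rfl

/-- Locality of the shuffle: it lets an induction hypothesis known only for words up to the length
of `ζ` be used inside a shuffle. -/
theorem shuf_congr {c c' d d' : Word m → A} (ζ : Word m)
    (hc : ∀ ξ : Word m, ξ.length ≤ ζ.length → c ξ = c' ξ)
    (hd : ∀ ξ : Word m, ξ.length ≤ ζ.length → d ξ = d' ξ) : shuf c d ζ = shuf c' d' ζ := by
  induction ζ generalizing c c' d d' with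
  | nil => simp [shuf, hc [] le_rfl, hd [] le_rfl]
  | cons i ζ ih =>
    simp only [List.length_cons] at hc hd
    simp only [shuf]
    congr 1
    · exact ih (fun ξ hξ => hc _ (by simpa using hξ)) (fun ξ hξ => hd _ (by omega))
    · exact ih (fun ξ hξ => hc _ (by omega)) (fun ξ hξ => hd _ (by simpa using hξ))

theorem shuf_comm (c d : Word m → A) : shuf c d = shuf d c := by
  funext ζ
  induction ζ generalizing c d with
  | nil => simp [shuf, mul_comm]
  | cons i ζ ih => simp only [shuf]; rw [ih, ih c, add_comm]

theorem shuf_add_right (c d e : Word m → A) : shuf c (d + e) = shuf c d + shuf c e := by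
  funext ζ
  induction ζ generalizing c d e with
  | nil => simp [shuf, mul_add]
  | cons i ζ ih => simp only [shuf, Pi.add_apply, leftDeriv_add, ih]; ring

theorem shuf_add_left (c d e : Word m → A) : shuf (c + d) e = shuf c e + shuf d e := by
  rw [shuf_comm, shuf_add_right, shuf_comm e, shuf_comm e]

theorem shuf_smul_right (a : A) (c d : Word m → A) : shuf c (a • d) = a • shuf c d := by
  funext ζ
  induction ζ generalizing c d with
  | nil => simp [shuf, mul_left_comm]
  | cons i ζ ih =>
    have h : leftDeriv i (a • d) = a • leftDeriv i d := rfl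
    simp only [shuf, h, ih, Pi.smul_apply, smul_add]

theorem shuf_zero_right (c : Word m → A) : shuf c 0 = 0 := by
  simpa using shuf_smul_right 0 c 0

theorem shuf_zero_left (c : Word m → A) : shuf 0 c = 0 := by
  rw [shuf_comm, shuf_zero_right]

theorem shuf_eq_zero (c d : Word m → A) (ζ : Word m)
    (hd : ∀ ξ : Word m, ξ.length ≤ ζ.length → d ξ = 0) : shuf c d ζ = 0 := by
  rw [shuf_congr (c' := c) (d' := 0) ζ (fun _ _ => rfl) hd, shuf_zero_right]
  rfl

theorem shuf_sum_right {ι : Type*} (s : Finset ι) (c : Word m → A) (f : ι → Word m → A) :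
    shuf c (∑ i ∈ s, f i) = ∑ i ∈ s, shuf c (f i) := by
  classical
  induction s using Finset.induction_on with
  | empty => simp [shuf_zero_right]
  | insert i s hi ih => rw [Finset.sum_insert hi, Finset.sum_insert hi, shuf_add_right, ih]

theorem shuf_sum_left {ι : Type*} (s : Finset ι) (c : Word m → A) (f : ι → Word m → A) :
    shuf (∑ i ∈ s, f i) c = ∑ i ∈ s, shuf (f i) c := by
  simp only [shuf_comm _ c, shuf_sum_right]

theorem shuf_assoc (c d e : Word m → A) : shuf (shuf c d) e = shuf c (shuf d e) := by
  funext ζ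
  induction ζ generalizing c d e with
  | nil => simp [shuf, mul_assoc]
  | cons i ζ ih =>
    change shuf (leftDeriv i (shuf c d)) e ζ + shuf (shuf c d) (leftDeriv i e) ζ
      = shuf (leftDeriv i c) (shuf d e) ζ + shuf c (leftDeriv i (shuf d e)) ζ
    simp only [leftDeriv_shuf, shuf_add_left, shuf_add_right, Pi.add_apply, ih]
    ring

theorem shuf_left_comm (c d e : Word m → A) : shuf c (shuf d e) = shuf d (shuf c e) := by
  rw [← shuf_assoc, shuf_comm c d, shuf_assoc]

theorem map_shuf (f : A →+* B) (c d : Word m → A) (ζ : Word m) :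
    f (shuf c d ζ) = shuf (f ∘ c) (f ∘ d) ζ := by
  induction ζ generalizing c d with
  | nil => simp [shuf]
  | cons i ζ ih => simp only [shuf, map_add, ih]; rfl

/-- The series `φ_d(η)(1)` with coefficients in `A`. -/
def phiOne (d : Fin m → Word m → A) : Word m → Word m → A
  | [], [] => 1
  | [], _ :: _ => 0
  | _ :: _, [] => 0
  | i :: η, j :: ζ => (if j = i then phiOne d η ζ else 0) +
      if j = 0 then shuf (Fin.cases 0 d i : Word m → A) (phiOne d η) ζ else 0

/-- Each letter of `η` prepends a letter to every word, so the sum defining `comp` is finite at each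
coefficient. -/
theorem phiOne_eq_zero (d : Fin m → Word m → A) (η ξ : Word m) (h : ξ.length < η.length) :
    phiOne d η ξ = 0 := by
  induction η generalizing ξ with
  | nil => simp at h
  | cons i η ih =>
    cases ξ with
    | nil => simp [phiOne]
    | cons j ξ =>
      have h' : ξ.length < η.length := by simpa using h
      simp [phiOne, ih ξ h', shuf_eq_zero _ _ ξ fun ξ' hξ' => ih ξ' (by omega)]

/-- The modified composition product of series with coefficients in `A`. -/
def comp (c : Word m → A) (d : Fin m → Word m → A) : Word m → A := fun ξ =>
  ∑ᶠ η : Word m, c η * phiOne d η ξ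

theorem comp_support_subset (c : Word m → A) (d : Fin m → Word m → A) (ξ : Word m) :
    (Function.support fun η : Word m => c η * phiOne d η ξ) ⊆
      {η : Word m | η.length ≤ ξ.length} := by
  intro η hη
  by_contra hlt
  simp only [Set.mem_ofPred_eq, not_le] at hlt
  simp [phiOne_eq_zero d η ξ hlt] at hη

theorem comp_eq_sum (c : Word m → A) (d : Fin m → Word m → A) (n : ℕ) (ξ : Word m)
    (h : ξ.length ≤ n) :
    comp c d ξ = ∑ η ∈ (finite_words_length_le m n).toFinset, c η * phiOne d η ξ := by
  refine finsum_eq_sum_of_support_subset _ ((comp_support_subset c d ξ).trans ?_)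
  intro η hη
  simp only [Set.mem_ofPred_eq, Set.Finite.coe_toFinset] at hη ⊢
  omega

theorem finsum_words (f : Word m → A) (hf : f.support.Finite) :
    ∑ᶠ η, f η = f [] + ∑ i, ∑ᶠ η, f (i :: η) := by
  classical
  -- Both sides are additive in `f`, so as a `Finsupp` it may be taken supported at a single word.
  obtain ⟨g, rfl⟩ : ∃ g : Word m →₀ A, f = g := ⟨Finsupp.ofSupportFinite f hf, rfl⟩
  clear hf
  have hfin (g : Word m →₀ A) (i : Fin (m + 1)) :
      (Function.support fun η => g (i :: η)).Finite :=
    (g.hasFiniteSupport.preimage (f := fun η => i :: η) fun a _ b _ h => by simpa using h)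
  induction g using Finsupp.induction_linear with
  | zero => simp
  | add f g hf hg =>
    simp only [Finsupp.add_apply]
    rw [finsum_add_distrib f.hasFiniteSupport g.hasFiniteSupport, hf, hg]
    simp only [finsum_add_distrib (hfin f _) (hfin g _), Finset.sum_add_distrib]
    ring
  | single η a =>
    rw [finsum_eq_single _ η (fun x hx => Finsupp.single_eq_of_ne hx)]
    cases η with
    | nil => simp
    | cons j η =>
      have h (i : Fin (m + 1)) : ∑ᶠ ξ, Finsupp.single (j :: η) a (i :: ξ) = if i = j then a else 0 := by
        split_ifs with hij
        · subst hij
          rw [finsum_eq_single _ η (fun x hx => by simp [hx.symm])]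
          simp
        · simp [Ne.symm hij]
      simp only [h]
      simp

theorem comp_nil (c : Word m → A) (d : Fin m → Word m → A) : comp c d [] = c [] := by
  rw [comp, finsum_eq_single _ [] (fun η hη => ?_)]
  · simp [phiOne]
  · cases η with
    | nil => exact absurd rfl hη
    | cons i η => simp [phiOne]

/-- Only words `η` no longer than `ζ` contribute on either side, so the infinite sum passes through
the shuffle as a finite one. -/
theorem shuf_comp (c e : Word m → A) (d : Fin m → Word m → A) (ζ : Word m) :
    ∑ᶠ η, c η * shuf e (phiOne d η) ζ = shuf e (comp c d) ζ := by
  set s := (finite_words_length_le m ζ.length).toFinset with hs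
  rw [shuf_congr (c' := e) (d' := ∑ η ∈ s, c η • phiOne d η) ζ (fun _ _ => rfl)
    (fun ξ hξ => by simp [comp_eq_sum c d _ ξ hξ, hs]), shuf_sum_right]
  simp only [shuf_smul_right, Finset.sum_apply, Pi.smul_apply, smul_eq_mul]
  refine finsum_eq_sum_of_support_subset _ fun η hη => ?_
  simp only [hs, Set.Finite.coe_toFinset, Set.mem_ofPred_eq]
  by_contra hlt
  exact hη (by simp [shuf_eq_zero e _ ζ fun ξ hξ => phiOne_eq_zero d η ξ (by omega)])

/-- Splitting the sum by the first letter of `η` gives a recursion that, with `comp_nil`,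
characterises `comp`. -/
theorem comp_cons (c : Word m → A) (d : Fin m → Word m → A) (j : Fin (m + 1)) (ζ : Word m) :
    comp c d (j :: ζ) = comp (leftDeriv j c) d ζ +
      if j = 0 then ∑ i : Fin m, shuf (d i) (comp (leftDeriv i.succ c) d) ζ else 0 := by
  have hfin (c e : Word m → A) : (Function.support fun η => c η * shuf e (phiOne d η) ζ).Finite := by
    refine (finite_words_length_le m ζ.length).subset fun η hη => ?_
    by_contra hlt
    simp only [Set.mem_ofPred_eq, not_le] at hlt
    exact hη (by simp [shuf_eq_zero e _ ζ fun ξ hξ => phiOne_eq_zero d η ξ (by omega)])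
  have hfin' (c : Word m → A) : (Function.support fun η => c η * phiOne d η ζ).Finite :=
    (finite_words_length_le m ζ.length).subset (comp_support_subset c d ζ)
  have key (i : Fin (m + 1)) : ∑ᶠ η, c (i :: η) * phiOne d (i :: η) (j :: ζ) =
      (if j = i then comp (leftDeriv i c) d ζ else 0) +
      if j = 0 then shuf (Fin.cases 0 d i : Word m → A) (comp (leftDeriv i c) d) ζ else 0 := by
    rw [← shuf_comp]
    have h1 := hfin (leftDeriv i c) (Fin.cases 0 d i)
    have h2 := hfin' (leftDeriv i c)
    simp only [phiOne, mul_add, mul_ite, mul_zero]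
    split_ifs
    · exact finsum_add_distrib h2 h1
    · simp only [add_zero]; rfl
    · simp only [zero_add]; rfl
    · simp
  rw [comp, finsum_words _ ((finite_words_length_le m _).subset (comp_support_subset c d _))]
  simp only [key, Finset.sum_add_distrib]
  rw [Finset.sum_ite_eq]
  simp only [Finset.mem_univ, if_true, phiOne, mul_zero, zero_add]
  congr 1
  split_ifs
  · rw [Fin.sum_univ_succ]
    simp [shuf_zero_left]
  · simp

theorem leftDeriv_succ_comp (c : Word m → A) (d : Fin m → Word m → A) (j : Fin m) :
    leftDeriv j.succ (comp c d) = comp (leftDeriv j.succ c) d := by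
  funext ζ
  simp [leftDeriv, comp_cons]

theorem leftDeriv_zero_comp (c : Word m → A) (d : Fin m → Word m → A) :
    leftDeriv 0 (comp c d) = comp (leftDeriv 0 c) d +
      ∑ i : Fin m, shuf (d i) (comp (leftDeriv i.succ c) d) := by
  funext ζ
  simp [leftDeriv, comp_cons]

end Coefficients

/-! ### The group law, its naturality and its homogeneity -/

section CompositionGroup

variable {m : ℕ} {A B : Type*} [CommRing A] [CommRing B]

theorem comp_zero_cons (c : Word m → A) (d : Fin m → Word m → A) (ζ : Word m) :
    comp c d (0 :: ζ) = comp (leftDeriv 0 c) d ζ +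
      ∑ i : Fin m, shuf (d i) (comp (leftDeriv i.succ c) d) ζ := by
  simp [comp_cons]

theorem comp_succ_cons (c : Word m → A) (d : Fin m → Word m → A) (j : Fin m) (ζ : Word m) :
    comp c d (j.succ :: ζ) = comp (leftDeriv j.succ c) d ζ := by
  simp [comp_cons]

/-- Induction over words for statements about all shorter words, by cases on the first letter. -/
theorem word_induction {P : Word m → Prop} (nil : P [])
    (zero : ∀ ζ, (∀ ξ : Word m, ξ.length ≤ ζ.length → P ξ) → P (0 :: ζ))
    (succ : ∀ (j : Fin m) ζ, P ζ → P (j.succ :: ζ)) (ζ : Word m) : P ζ := by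
  induction h : ζ.length using Nat.strong_induction_on generalizing ζ with
  | _ n ih =>
    subst h
    cases ζ with
    | nil => exact nil
    | cons i ζ =>
      cases i using Fin.cases with
      | zero => exact zero ζ fun ξ hξ => ih _ (by simp; omega) ξ rfl
      | succ j => exact succ j ζ (ih _ (by simp) ζ rfl)

theorem comp_add (b c : Word m → A) (d : Fin m → Word m → A) :
    comp (b + c) d = comp b d + comp c d := by
  funext ξ
  simp only [comp_eq_sum _ d _ ξ le_rfl, Pi.add_apply, add_mul, Finset.sum_add_distrib]

theorem zero_comp (d : Fin m → Word m → A) : comp 0 d = 0 := by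
  funext ξ
  simp [comp]

theorem sum_comp {ι : Type*} (s : Finset ι) (f : ι → Word m → A) (d : Fin m → Word m → A) :
    comp (∑ i ∈ s, f i) d = ∑ i ∈ s, comp (f i) d := by
  classical
  induction s using Finset.induction_on with
  | empty => simp [zero_comp]
  | insert i s hi ih => rw [Finset.sum_insert hi, Finset.sum_insert hi, comp_add, ih]

theorem comp_zero (c : Word m → A) : comp c (0 : Fin m → Word m → A) = c := by
  funext ζ
  induction ζ using word_induction generalizing c with
  | nil => rw [comp_nil]
  | zero ζ ih => simp [comp_zero_cons, ih ζ le_rfl, shuf_zero_left, leftDeriv]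
  | succ j ζ ih => rw [comp_succ_cons, ih]; rfl

/-- Composition with a fixed series is a morphism for the shuffle product. -/
theorem comp_shuf (a b : Word m → A) (e : Fin m → Word m → A) :
    comp (shuf a b) e = shuf (comp a e) (comp b e) := by
  funext ζ
  induction ζ using word_induction generalizing a b with
  | nil => simp [comp_nil, shuf]
  | zero ζ ih =>
    -- The shuffle with `e i` involves coefficients at all words up to the length of `ζ`, hence the
    -- strong induction hypothesis.
    have key (i : Fin m) : shuf (e i) (comp (leftDeriv i.succ (shuf a b)) e) ζ =
        shuf (e i) (shuf (comp (leftDeriv i.succ a) e) (comp b e) +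
          shuf (comp a e) (comp (leftDeriv i.succ b) e)) ζ :=
      shuf_congr ζ (fun _ _ => rfl) fun ξ hξ => by
        rw [leftDeriv_shuf, comp_add, Pi.add_apply, ih ξ hξ, ih ξ hξ, Pi.add_apply]
    rw [comp_zero_cons]
    simp only [key, shuf, leftDeriv_zero_comp, shuf_add_left, shuf_sum_left, shuf_add_right,
      shuf_sum_right]
    rw [leftDeriv_shuf, comp_add, Pi.add_apply, ih ζ le_rfl, ih ζ le_rfl]
    simp only [Pi.add_apply, Finset.sum_apply, Finset.sum_add_distrib, shuf_assoc,
      shuf_left_comm (comp a e) (e _)]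
    ring
  | succ j ζ ih =>
    rw [comp_succ_cons, leftDeriv_shuf, comp_add]
    simp only [Pi.add_apply, shuf, leftDeriv_succ_comp, ih]

/-- Under `∂_0` the left side yields corrections from `e` and from `d`. By `comp_shuf` the latter
become shuffles with `d_i ∘̃ e`, so together they are the correction for `e_i + d_i ∘̃ e`. -/
theorem comp_comp (c : Word m → A) (d e : Fin m → Word m → A) :
    comp (comp c d) e = comp c (fun i => e i + comp (d i) e) := by
  funext ζ
  induction ζ using word_induction generalizing c with
  | nil => simp [comp_nil]
  | zero ζ ih =>
    have key (i : Fin m) : shuf (e i + comp (d i) e)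
        (comp (leftDeriv i.succ c) (fun i => e i + comp (d i) e)) ζ =
        shuf (e i + comp (d i) e) (comp (comp (leftDeriv i.succ c) d) e) ζ :=
      shuf_congr ζ (fun _ _ => rfl) fun ξ hξ => (ih ξ hξ _).symm
    rw [comp_zero_cons, comp_zero_cons]
    simp only [key]
    rw [leftDeriv_zero_comp, comp_add, sum_comp, Pi.add_apply, ih ζ le_rfl]
    simp only [leftDeriv_succ_comp, comp_shuf, shuf_add_left, Pi.add_apply, Finset.sum_apply,
      Finset.sum_add_distrib]
    ring
  | succ j ζ ih => rw [comp_succ_cons, comp_succ_cons, leftDeriv_succ_comp, ih]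

/-- The group product `d + c ∘̃ d` for series with coefficients in `A`. -/
def gprod (c d : Fin m → Word m → A) : Fin m → Word m → A := fun i => d i + comp (c i) d

theorem gprod_assoc (c d e : Fin m → Word m → A) :
    gprod (gprod c d) e = gprod c (gprod d e) := by
  funext i
  simp only [gprod, comp_add, comp_comp]
  rw [add_assoc]
  rfl

theorem gprod_zero (c : Fin m → Word m → A) : gprod c 0 = c := by
  funext i
  simp [gprod, comp_zero]

theorem zero_gprod (c : Fin m → Word m → A) : gprod 0 c = c := by
  funext i
  simp [gprod, zero_comp]

/-- The solution `e` of `e ∘̃ d = g`. -/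
def compInv (d : Fin m → Word m → A) : (Word m → A) → Word m → A
  | g, [] => g []
  | g, i :: ζ => compInv d (leftDeriv i g -
      if i = 0 then ∑ k : Fin m, shuf (d k) (leftDeriv k.succ g) else 0) ζ

theorem leftDeriv_zero_compInv (d : Fin m → Word m → A) (g : Word m → A) :
    leftDeriv 0 (compInv d g) =
      compInv d (leftDeriv 0 g - ∑ k : Fin m, shuf (d k) (leftDeriv k.succ g)) := by
  funext ζ
  simp [leftDeriv, compInv]

theorem leftDeriv_succ_compInv (d : Fin m → Word m → A) (g : Word m → A) (j : Fin m) :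
    leftDeriv j.succ (compInv d g) = compInv d (leftDeriv j.succ g) := by
  funext ζ
  simp [leftDeriv, compInv]

/-- `compInv` subtracts in advance exactly the correction that `comp` adds at the letter `x_0`. -/
theorem comp_compInv (d : Fin m → Word m → A) (g : Word m → A) : comp (compInv d g) d = g := by
  funext ζ
  induction ζ using word_induction generalizing g with
  | nil => simp [comp_nil, compInv]
  | zero ζ ih =>
    have key (i : Fin m) : shuf (d i) (comp (leftDeriv i.succ (compInv d g)) d) ζ =
        shuf (d i) (leftDeriv i.succ g) ζ :=
      shuf_congr ζ (fun _ _ => rfl) fun ξ hξ => by rw [leftDeriv_succ_compInv, ih ξ hξ]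
    rw [comp_zero_cons, leftDeriv_zero_compInv, ih ζ le_rfl]
    simp [key, leftDeriv]
  | succ j ζ ih => rw [comp_succ_cons, leftDeriv_succ_compInv, ih]; rfl

/-- The inverse of a series for the group product. -/
def ginv (d : Fin m → Word m → A) : Fin m → Word m → A := fun i => compInv d (-d i)

theorem ginv_gprod (d : Fin m → Word m → A) : gprod (ginv d) d = 0 := by
  funext i
  simp [gprod, ginv, comp_compInv]

/-- In a monoid where every element has a left inverse, left inverses are two-sided. -/
theorem gprod_ginv (d : Fin m → Word m → A) : gprod d (ginv d) = 0 := by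
  have h : ginv (ginv d) = d := by
    rw [← gprod_zero (ginv (ginv d)), ← ginv_gprod d, ← gprod_assoc, ginv_gprod, zero_gprod]
  have := ginv_gprod (ginv d)
  rwa [h] at this

/-- The recursion uses only ring operations on coefficients, so it is preserved by change of ring.
-/
theorem map_comp (f : A →+* B) (c : Word m → A) (d : Fin m → Word m → A) (ζ : Word m) :
    f (comp c d ζ) = comp (f ∘ c) (fun i => f ∘ d i) ζ := by
  induction ζ using word_induction generalizing c with
  | nil => simp [comp_nil]
  | zero ζ ih =>
    rw [comp_zero_cons, comp_zero_cons, map_add, map_sum, ih ζ le_rfl]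
    congr 1
    refine Finset.sum_congr rfl fun i _ => ?_
    rw [map_shuf]
    exact shuf_congr ζ (fun _ _ => rfl) fun ξ hξ => ih ξ hξ _
  | succ j ζ ih => rw [comp_succ_cons, comp_succ_cons, ih]; rfl

theorem map_gprod (f : A →+* B) (c d : Fin m → Word m → A) (i : Fin m) (ζ : Word m) :
    f (gprod c d i ζ) = gprod (fun i => f ∘ c i) (fun i => f ∘ d i) i ζ := by
  simp only [gprod, Pi.add_apply, map_add, map_comp]
  rfl

/-- The weight of a word: `x_0` counts twice. -/
def weight (η : Word m) : ℕ := (η.map fun i => if i = 0 then 2 else 1).sum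

theorem weight_zero_cons (η : Word m) : weight (0 :: η) = weight η + 2 := by
  simp [weight, add_comm]

theorem weight_succ_cons (j : Fin m) (η : Word m) : weight (j.succ :: η) = weight η + 1 := by
  simp [weight, add_comm]

variable {R : Type*} [CommRing R] [Algebra R A] (𝒜 : ℕ → Submodule R A)

/-- The coefficient of `η` in `c` has degree `weight η + k`. -/
def IsHomogeneousSeries (k : ℕ) (c : Word m → A) : Prop := ∀ η, c η ∈ 𝒜 (weight η + k)

variable {𝒜}

theorem IsHomogeneousSeries.leftDeriv_zero {k : ℕ} {c : Word m → A}
    (hc : IsHomogeneousSeries 𝒜 k c) : IsHomogeneousSeries 𝒜 (k + 2) (leftDeriv 0 c) := by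
  intro η
  have := hc (0 :: η)
  rwa [weight_zero_cons, add_assoc, add_comm 2] at this

theorem IsHomogeneousSeries.leftDeriv_succ {k : ℕ} {c : Word m → A}
    (hc : IsHomogeneousSeries 𝒜 k c) (j : Fin m) :
    IsHomogeneousSeries 𝒜 (k + 1) (leftDeriv j.succ c) := by
  intro η
  have := hc (j.succ :: η)
  rwa [weight_succ_cons, add_assoc, add_comm 1] at this

variable [SetLike.GradedMonoid 𝒜]

theorem IsHomogeneousSeries.shuf {k l : ℕ} {c d : Word m → A}
    (hc : IsHomogeneousSeries 𝒜 k c) (hd : IsHomogeneousSeries 𝒜 l d) :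
    IsHomogeneousSeries 𝒜 (k + l) (shuf c d) := by
  intro ζ
  induction ζ generalizing c d k l with
  | nil => simpa [OutputFeedback.shuf, weight] using SetLike.mul_mem_graded (hc []) (hd [])
  | cons i ζ ih =>
    cases i using Fin.cases with
    | zero =>
      rw [weight_zero_cons]
      have h1 := ih hc.leftDeriv_zero hd
      have h2 := ih hc hd.leftDeriv_zero
      rw [show weight ζ + (k + 2 + l) = weight ζ + 2 + (k + l) by ring] at h1
      rw [show weight ζ + (k + (l + 2)) = weight ζ + 2 + (k + l) by ring] at h2
      exact add_mem h1 h2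
    | succ j =>
      rw [weight_succ_cons]
      have h1 := ih (hc.leftDeriv_succ j) hd
      have h2 := ih hc (hd.leftDeriv_succ j)
      rw [show weight ζ + (k + 1 + l) = weight ζ + 1 + (k + l) by ring] at h1
      rw [show weight ζ + (k + (l + 1)) = weight ζ + 1 + (k + l) by ring] at h2
      exact add_mem h1 h2

/-- The shift by 2 from `∂_0` equals the shift by 1 from `∂_i` plus the degree 1 of `d_i`. -/
theorem IsHomogeneousSeries.comp {k : ℕ} {c : Word m → A} {d : Fin m → Word m → A}
    (hc : IsHomogeneousSeries 𝒜 k c) (hd : ∀ i, IsHomogeneousSeries 𝒜 1 (d i)) :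
    IsHomogeneousSeries 𝒜 k (comp c d) := by
  intro ζ
  induction ζ using word_induction generalizing k c with
  | nil => simpa [comp_nil] using hc []
  | zero ζ ih =>
    rw [comp_zero_cons, weight_zero_cons, add_assoc, add_comm 2]
    refine add_mem (ih ζ le_rfl hc.leftDeriv_zero) (sum_mem fun i _ => ?_)
    -- Homogeneity is known so far only on words up to the length of `ζ`; truncating makes it hold
    -- everywhere without changing the shuffle at `ζ`.
    have htrunc : IsHomogeneousSeries 𝒜 (k + 1) fun ξ : Word m => if ξ.length ≤ ζ.length then
        OutputFeedback.comp (leftDeriv i.succ c) d ξ else 0 := fun ξ => by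
      dsimp only
      split_ifs with hξ
      · exact ih ξ hξ (hc.leftDeriv_succ i)
      · exact zero_mem _
    have := (hd i).shuf htrunc ζ
    rw [show 1 + (k + 1) = k + 2 by ring] at this
    rwa [shuf_congr ζ (fun _ _ => rfl) fun ξ hξ => (if_pos hξ).symm]
  | succ j ζ ih =>
    rw [comp_succ_cons, weight_succ_cons, add_assoc, add_comm 1]
    exact ih (hc.leftDeriv_succ j)

theorem IsHomogeneousSeries.compInv {k : ℕ} {g : Word m → A} {d : Fin m → Word m → A}
    (hg : IsHomogeneousSeries 𝒜 k g) (hd : ∀ i, IsHomogeneousSeries 𝒜 1 (d i)) :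
    IsHomogeneousSeries 𝒜 k (compInv d g) := by
  intro ζ
  induction ζ using word_induction generalizing k g with
  | nil => simpa [OutputFeedback.compInv] using hg []
  | zero ζ ih =>
    rw [weight_zero_cons, add_assoc, add_comm 2]
    change leftDeriv 0 (OutputFeedback.compInv d g) ζ ∈ _
    rw [leftDeriv_zero_compInv]
    refine ih ζ le_rfl fun η => sub_mem (hg.leftDeriv_zero η) ?_
    rw [Finset.sum_apply]
    refine sum_mem fun i _ => ?_
    have := (hd i).shuf (hg.leftDeriv_succ i) η
    rwa [show 1 + (k + 1) = k + 2 by ring] at this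
  | succ j ζ ih =>
    rw [weight_succ_cons, add_assoc, add_comm 1]
    change leftDeriv j.succ (OutputFeedback.compInv d g) ζ ∈ _
    rw [leftDeriv_succ_compInv]
    exact ih (hg.leftDeriv_succ j)

theorem gprod_mem {c d : Fin m → Word m → A} (hc : ∀ i, IsHomogeneousSeries 𝒜 1 (c i))
    (hd : ∀ i, IsHomogeneousSeries 𝒜 1 (d i)) (i : Fin m) (η : Word m) :
    gprod c d i η ∈ 𝒜 (weight η + 1) :=
  add_mem (hd i η) ((hc i).comp hd η)

theorem ginv_mem {d : Fin m → Word m → A} (hd : ∀ i, IsHomogeneousSeries 𝒜 1 (d i))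
    (i : Fin m) (η : Word m) : ginv d i η ∈ 𝒜 (weight η + 1) :=
  IsHomogeneousSeries.compInv (fun η => neg_mem (hd i η)) hd η

end CompositionGroup

/-! ### Agreement with the given shuffle, composition and degree -/

section RealCoefficients

variable {m : ℕ}

theorem shuffleWord_nil_right (η : Word m) : shuffleWord η [] = {η} := by
  cases η <;> simp [shuffleWord]

theorem count_cons_map_cons (i j : Fin (m + 1)) (ζ : Word m) (s : Multiset (Word m)) :
    (s.map (j :: ·)).count (i :: ζ) = if j = i then s.count ζ else 0 := by
  split_ifs with h
  · subst h
    exact Multiset.count_map_eq_count' _ _ (fun a b h => by simpa using h) _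
  · refine Multiset.count_eq_zero_of_notMem fun hmem => ?_
    simp only [Multiset.mem_map, List.cons.injEq] at hmem
    obtain ⟨_, _, h', _⟩ := hmem
    exact h h'

/-- `count ζ (∂_i η ⧢ ξ)`. -/
def countDerivLeft (i : Fin (m + 1)) (ζ : Word m) : Word m → Word m → ℕ
  | [], _ => 0
  | j :: η, ξ => if j = i then (shuffleWord η ξ).count ζ else 0

/-- `count ζ (η ⧢ ∂_i ξ)`. -/
def countDerivRight (i : Fin (m + 1)) (ζ : Word m) : Word m → Word m → ℕ
  | _, [] => 0
  | η, j :: ξ => if j = i then (shuffleWord η ξ).count ζ else 0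

/-- The first letter of a word in a shuffle comes from one of the two factors: the Leibniz rule for
multiplicities. -/
theorem count_cons_shuffleWord (i : Fin (m + 1)) (ζ η ξ : Word m) :
    (shuffleWord η ξ).count (i :: ζ) = countDerivLeft i ζ η ξ + countDerivRight i ζ η ξ := by
  cases η with
  | nil =>
    cases ξ with
    | nil => simp [shuffleWord, countDerivLeft, countDerivRight]
    | cons j ξ =>
      have := count_cons_map_cons i j ζ {ξ}
      simpa [shuffleWord, countDerivLeft, countDerivRight] using this
  | cons k η =>
    cases ξ with
    | nil =>
      have := count_cons_map_cons i k ζ {η}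
      simpa [shuffleWord, countDerivLeft, countDerivRight, shuffleWord_nil_right] using this
    | cons j ξ =>
      simp [shuffleWord, countDerivLeft, countDerivRight, count_cons_map_cons]

theorem finsum_eq_finsum_comp {α β : Type*} (f : β → ℝ) (g : α → β) (hg : g.Injective)
    (hf : f.support ⊆ Set.range g) : ∑ᶠ b, f b = ∑ᶠ a, f (g a) := by
  rw [← finsum_mem_range hg, ← finsum_mem_univ]
  exact finsum_mem_inter_support_eq f _ _ (by rw [Set.univ_inter, Set.inter_eq_right.mpr hf])

theorem shuffle_eq_shuf (c d : Series m) : shuffle c d = shuf c d := by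
  funext ζ
  induction ζ generalizing c d with
  | nil =>
    rw [shuffle, finsum_eq_single _ ([], []) (fun p hp => ?_)]
    · simp [shuffleWord, shuf]
    · have : (shuffleWord p.1 p.2).count [] = 0 := by
        refine Multiset.count_eq_zero_of_notMem fun h => hp ?_
        have := length_of_mem_shuffleWord _ _ _ h
        simp only [List.length_nil] at this
        exact Prod.ext (List.eq_nil_of_length_eq_zero (by omega))
          (List.eq_nil_of_length_eq_zero (by omega))
      simp [this]
  | cons i ζ ih =>
    -- Only pairs whose first word starts with `i` contribute; stripping that letter turns the sum
    -- into a shuffle with `∂_i c`. The sum `hr` does the same for `d`.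
    have hl := finsum_eq_finsum_comp
      (fun p : Word m × Word m => c p.1 * d p.2 * (countDerivLeft i ζ p.1 p.2 : ℝ))
      (fun p : Word m × Word m => (i :: p.1, p.2)) (fun p q h => by simpa [Prod.ext_iff] using h) (by
        rintro ⟨_ | ⟨j, η⟩, ξ⟩ h
        · simp [countDerivLeft] at h
        · have : j = i := by
            by_contra hji
            simp [countDerivLeft, hji] at h
          exact ⟨(η, ξ), by simp [this]⟩)
    have hr := finsum_eq_finsum_comp
      (fun p : Word m × Word m => c p.1 * d p.2 * (countDerivRight i ζ p.1 p.2 : ℝ))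
      (fun p : Word m × Word m => (p.1, i :: p.2)) (fun p q h => by simpa [Prod.ext_iff] using h) (by
        rintro ⟨η, _ | ⟨j, ξ⟩⟩ h
        · simp [countDerivRight] at h
        · have : j = i := by
            by_contra hji
            simp [countDerivRight, hji] at h
          exact ⟨(η, ξ), by simp [this]⟩)
    have hfin := shuffle_finite_support c d (i :: ζ)
    rw [shuf, ← ih, ← ih]
    simp only [shuffle] at hfin ⊢
    simp only [count_cons_shuffleWord, Nat.cast_add, mul_add] at hfin ⊢
    rw [finsum_add_distrib, hl, hr]
    · simp [countDerivLeft, countDerivRight, leftDeriv]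
    · refine hfin.subset fun p hp => ?_
      simp only [Function.mem_support, ne_eq, mul_eq_zero, not_or, Nat.cast_eq_zero, ← mul_add]
        at hp ⊢
      refine ⟨hp.1, ?_⟩
      norm_cast
      omega
    · refine hfin.subset fun p hp => ?_
      simp only [Function.mem_support, ne_eq, mul_eq_zero, not_or, Nat.cast_eq_zero, ← mul_add]
        at hp ⊢
      refine ⟨hp.1, ?_⟩
      norm_cast
      omega

theorem phi_oneSeries (d : VSeries m) (η : Word m) : phi d η (oneSeries m) = phiOne d η := by
  induction η with
  | nil => funext ξ; cases ξ <;> rfl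
  | cons i η ih =>
    funext ξ
    cases ξ with
    | nil => simp [phi, phiLetter, letterMul, phiOne]
    | cons j ξ =>
      simp only [phi, phiLetter, Pi.add_apply, letterMul, phiOne, shuffle_eq_shuf, ih]

theorem feedbackProd_eq_gprod (c d : VSeries m) : feedbackProd c d = gprod c d := by
  funext i
  refine congrArg (d i + ·) (funext fun ξ => ?_)
  simp only [modComp, comp, phi_oneSeries]

theorem deg_eq (i : Fin m) (η : Word m) : deg (i, η) = weight η + 1 := by
  unfold deg
  congr 1
  dsimp only
  induction η using word_induction with
  | nil => simp [weight]
  | zero ζ ih =>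
    rw [weight_zero_cons, ← ih ζ le_rfl]
    simp [(Fin.succ_ne_zero _).symm]
    ring
  | succ j ζ ih =>
    rw [weight_succ_cons, ← ih]
    simp [List.count_cons, Finset.sum_add_distrib]
    ring

end RealCoefficients

/-! ### The grading of the tensor square -/

section TensorGrading

variable {A : Type*} [CommRing A] [Algebra ℝ A] {𝒜 : ℕ → Submodule ℝ A}

theorem tmul_mem_tensorGrading {k l : ℕ} {a b : A} (ha : a ∈ 𝒜 k) (hb : b ∈ 𝒜 l) :
    a ⊗ₜ[ℝ] b ∈ tensorGrading 𝒜 (k + l) := by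
  have hle := le_iSup₂ (f := fun (p : ℕ × ℕ) (_ : p ∈ Finset.HasAntidiagonal.antidiagonal (k + l)) =>
    LinearMap.range (TensorProduct.map (𝒜 p.1).subtype (𝒜 p.2).subtype)) (k, l) (by simp)
  exact hle ⟨(⟨a, ha⟩ : 𝒜 k) ⊗ₜ[ℝ] (⟨b, hb⟩ : 𝒜 l), by simp⟩

theorem tensorGrading_le {n : ℕ} {P : Submodule ℝ (A ⊗[ℝ] A)}
    (h : ∀ k l, k + l = n → ∀ a ∈ 𝒜 k, ∀ b ∈ 𝒜 l, a ⊗ₜ[ℝ] b ∈ P) : tensorGrading 𝒜 n ≤ P := by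
  refine iSup₂_le fun p hp => ?_
  rintro _ ⟨t, rfl⟩
  induction t using TensorProduct.induction_on with
  | zero => simp
  | tmul a b => exact h p.1 p.2 (by simpa using hp) a a.2 b b.2
  | add s t hs ht => rw [map_add]; exact add_mem hs ht

instance tensorGrading.gradedMonoid [SetLike.GradedMonoid 𝒜] :
    SetLike.GradedMonoid (tensorGrading 𝒜) where
  one_mem := tmul_mem_tensorGrading (k := 0) (l := 0) SetLike.GradedOne.one_mem
    SetLike.GradedOne.one_mem
  mul_mem i j x y hx hy := by
    -- Linearity in each factor in turn reduces the claim to homogeneous pure tensors.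
    refine tensorGrading_le (P := (tensorGrading 𝒜 (i + j)).comap (LinearMap.mulRight ℝ y))
      (fun k l hkl a ha b hb => ?_) hx
    refine tensorGrading_le (P := (tensorGrading 𝒜 (i + j)).comap (LinearMap.mulLeft ℝ (a ⊗ₜ[ℝ] b)))
      (fun k' l' hkl' a' ha' b' hb' => ?_) hy
    rw [Submodule.mem_comap, LinearMap.mulLeft_apply, Algebra.TensorProduct.tmul_mul_tmul,
      ← hkl, ← hkl', add_add_add_comm]
    exact tmul_mem_tensorGrading (SetLike.mul_mem_graded ha ha') (SetLike.mul_mem_graded hb hb')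

end TensorGrading

/-! ### Coproduct, antipode and grading of `H` -/

section HopfAlgebra

variable {m : ℕ}

instance grading.gradedMonoid : SetLike.GradedMonoid (grading m) :=
  MvPolynomial.WeightedHomogeneousSubmodule.gradedMonoid

theorem grading_isInternal : DirectSum.IsInternal (grading m) :=
  letI := MvPolynomial.weightedDecomposition ℝ (deg (m := m))
  DirectSum.Decomposition.isInternal (MvPolynomial.weightedHomogeneousSubmodule ℝ (deg (m := m)))

theorem grading_zero : grading m 0 = Submodule.span ℝ {1} := by
  refine le_antisymm (fun a ha => ?_) ?_
  · have h0 : MvPolynomial.weightedHomogeneousComponent deg 0 a = a :=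
      MvPolynomial.IsWeightedHomogeneous.weightedHomogeneousComponent_same ha
    -- Connectedness: the `+ 1` in `deg` makes every generator of positive degree, so degree zero
    -- leaves only constants.
    rw [MvPolynomial.weightedHomogeneousComponent_zero a fun p => by simp [deg]] at h0
    rw [Submodule.mem_span_singleton]
    exact ⟨MvPolynomial.coeff 0 a, by rw [← MvPolynomial.algebraMap_eq] at h0; rw [← h0,
      Algebra.algebraMap_eq_smul_one]; simp⟩
  · rw [Submodule.span_singleton_le_iff_mem]
    exact SetLike.GradedOne.one_mem

theorem counit_eq_zero_of_mem_grading {n : ℕ} (hn : 0 < n) {a : H m} (ha : a ∈ grading m n) :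
    counit m a = 0 := by
  rw [counit, MvPolynomial.aeval_zero', MvPolynomial.constantCoeff_eq,
    MvPolynomial.IsWeightedHomogeneous.coeff_eq_zero ha 0 (by simpa using hn.ne), map_zero]

theorem coord_mem_grading (i : Fin m) (η : Word m) : coord i η ∈ grading m (weight η + 1) := by
  rw [← deg_eq i η]
  exact MvPolynomial.isWeightedHomogeneous_X ℝ deg (i, η)

theorem map_mem_of_mem_grading {B : Type*} [CommRing B] [Algebra ℝ B] (ℬ : ℕ → Submodule ℝ B)
    [SetLike.GradedMonoid ℬ] (f : H m →ₐ[ℝ] B)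
    (hf : ∀ i η, f (coord i η) ∈ ℬ (weight η + 1)) {n : ℕ} {a : H m} (ha : a ∈ grading m n) :
    f a ∈ ℬ n := by
  refine MvPolynomial.IsWeightedHomogeneous.induction_on
    (motive := fun p _ => f p ∈ ℬ n) ?_ ?_ ?_ ha
  · simp
  · intro p q _ _ hp hq
    rw [map_add]
    exact add_mem hp hq
  · intro d r hd
    rw [MvPolynomial.monomial_eq, ← MvPolynomial.algebraMap_eq, ← Algebra.smul_def, map_smul,
      Finsupp.prod, map_prod, ← hd, Finsupp.weight_apply]
    simp only [map_pow]
    refine Submodule.smul_mem _ _ (SetLike.prod_pow_mem_graded ℬ _ _ _ fun p _ => ?_)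
    rw [show p = (p.1, p.2) from rfl, deg_eq]
    exact hf p.1 p.2

/-- The coproduct of `H`: the group product of the two universal series over `H ⊗ H`. -/
def comulHom (m : ℕ) : H m →ₐ[ℝ] H m ⊗[ℝ] H m := MvPolynomial.aeval fun p =>
  gprod (fun i η => coord i η ⊗ₜ[ℝ] (1 : H m)) (fun i η => (1 : H m) ⊗ₜ[ℝ] coord i η) p.1 p.2

theorem comulHom_coord (i : Fin m) (η : Word m) : comulHom m (coord i η) =
    gprod (fun i η => coord i η ⊗ₜ[ℝ] (1 : H m)) (fun i η => (1 : H m) ⊗ₜ[ℝ] coord i η) i η := by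
  simp [comulHom, coord]

/-- By naturality, any algebra map out of `H ⊗ H` turns the coproduct into a product of series over
its target; each Hopf axiom then becomes a group identity. -/
theorem map_comulHom_coord {B : Type*} [CommRing B] [Algebra ℝ B] (F : H m ⊗[ℝ] H m →ₐ[ℝ] B)
    (i : Fin m) (η : Word m) : F (comulHom m (coord i η)) =
      gprod (fun i η => F (coord i η ⊗ₜ[ℝ] 1)) (fun i η => F (1 ⊗ₜ[ℝ] coord i η)) i η := by
  rw [comulHom_coord]
  exact map_gprod (F : H m ⊗[ℝ] H m →+* B) _ _ i η

theorem comulHom_isDualCoproduct : IsDualCoproduct (comulHom m) := by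
  intro i η c d
  rw [map_comulHom_coord, feedbackProd_eq_gprod]
  simp [evalPair, evalAt, coord]

/-- `H ⊗ H` is a polynomial ring on two copies of the coordinates, and every real assignment to them
is a pair of series; since `ℝ` is an infinite domain, values determine the polynomial. -/
theorem evalPair_injective {x y : H m ⊗[ℝ] H m} (h : ∀ c d, evalPair c d x = evalPair c d y) :
    x = y := by
  apply (MvPolynomial.tensorEquivSum ℝ (Fin m × Word m) (Fin m × Word m) ℝ).injective
  refine MvPolynomial.funext fun v => ?_
  have key : evalPair (fun i η => v (.inl (i, η))) (fun i η => v (.inr (i, η))) =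
      (MvPolynomial.aeval v).comp
        (MvPolynomial.tensorEquivSum ℝ (Fin m × Word m) (Fin m × Word m) ℝ).toAlgHom := by
    apply Algebra.TensorProduct.ext
    · ext p
      simp [evalPair, evalAt]
    · ext p
      simp [evalPair, evalAt]
  have := h (fun i η => v (.inl (i, η))) (fun i η => v (.inr (i, η)))
  rw [key] at this
  simpa [MvPolynomial.aeval_eq_eval] using this

theorem IsDualCoproduct.eq_comulHom {Δ : H m →ₐ[ℝ] H m ⊗[ℝ] H m} (h : IsDualCoproduct Δ) :
    Δ = comulHom m := by
  refine MvPolynomial.algHom_ext fun p => evalPair_injective fun c d => ?_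
  exact (h p.1 p.2 c d).trans (comulHom_isDualCoproduct p.1 p.2 c d).symm

theorem comulHom_coassoc : (Algebra.TensorProduct.assoc ℝ ℝ ℝ (H m) (H m) (H m)).toAlgHom.comp
      ((Algebra.TensorProduct.map (comulHom m) (.id ℝ (H m))).comp (comulHom m))
      = (Algebra.TensorProduct.map (.id ℝ (H m)) (comulHom m)).comp (comulHom m) := by
  refine MvPolynomial.algHom_ext fun p => ?_
  refine (map_comulHom_coord ((Algebra.TensorProduct.assoc ℝ ℝ ℝ (H m) (H m) (H m)).toAlgHom.comp
    (Algebra.TensorProduct.map (comulHom m) (.id ℝ (H m)))) p.1 p.2).trans (Eq.trans ?_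
    (map_comulHom_coord (B := H m ⊗[ℝ] (H m ⊗[ℝ] H m))
      (Algebra.TensorProduct.map (.id ℝ (H m)) (comulHom m)) p.1 p.2).symm)
  have hl (i : Fin m) (η : Word m) :
      (Algebra.TensorProduct.assoc ℝ ℝ ℝ (H m) (H m) (H m)) (comulHom m (coord i η) ⊗ₜ[ℝ] 1) =
      gprod (fun i η => coord i η ⊗ₜ[ℝ] ((1 : H m) ⊗ₜ[ℝ] (1 : H m)))
        (fun i η => (1 : H m) ⊗ₜ[ℝ] (coord i η ⊗ₜ[ℝ] (1 : H m))) i η := by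
    have := map_comulHom_coord (B := H m ⊗[ℝ] (H m ⊗[ℝ] H m))
      ((Algebra.TensorProduct.assoc ℝ ℝ ℝ (H m) (H m) (H m)).toAlgHom.comp
        (Algebra.TensorProduct.includeLeft : H m ⊗[ℝ] H m →ₐ[ℝ] (H m ⊗[ℝ] H m) ⊗[ℝ] H m)) i η
    simpa using this
  have hr (i : Fin m) (η : Word m) : (1 : H m) ⊗ₜ[ℝ] comulHom m (coord i η) =
      gprod (fun i η => (1 : H m) ⊗ₜ[ℝ] (coord i η ⊗ₜ[ℝ] (1 : H m)))
        (fun i η => (1 : H m) ⊗ₜ[ℝ] ((1 : H m) ⊗ₜ[ℝ] coord i η)) i η := by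
    have := map_comulHom_coord (B := H m ⊗[ℝ] (H m ⊗[ℝ] H m))
      Algebra.TensorProduct.includeRight i η
    simpa using this
  -- Both sides are the triple product of the universal series placed in the three tensor factors.
  have := congrFun (congrFun (gprod_assoc
    (fun i η => coord i η ⊗ₜ[ℝ] ((1 : H m) ⊗ₜ[ℝ] (1 : H m)))
    (fun i η => (1 : H m) ⊗ₜ[ℝ] (coord i η ⊗ₜ[ℝ] (1 : H m)))
    (fun i η => (1 : H m) ⊗ₜ[ℝ] ((1 : H m) ⊗ₜ[ℝ] coord i η))) p.1) p.2
  simpa [hl, hr, Algebra.TensorProduct.one_def] using this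

theorem counit_coord (i : Fin m) (η : Word m) : counit m (coord i η) = 0 := by
  simp [counit, coord]

theorem comulHom_counit_left :
    (Algebra.TensorProduct.map (counit m) (.id ℝ (H m))).comp (comulHom m)
      = (Algebra.TensorProduct.lid ℝ (H m)).symm := by
  refine MvPolynomial.algHom_ext fun p => ?_
  refine (map_comulHom_coord (Algebra.TensorProduct.map (counit m) (.id ℝ (H m))) p.1 p.2).trans ?_
  simp only [Algebra.TensorProduct.map_tmul, counit_coord, TensorProduct.zero_tmul]
  refine (congrFun (congrFun (zero_gprod (A := ℝ ⊗[ℝ] H m) _) p.1) p.2).trans ?_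
  simp [coord]

theorem comulHom_counit_right :
    (Algebra.TensorProduct.map (.id ℝ (H m)) (counit m)).comp (comulHom m)
      = (Algebra.TensorProduct.rid ℝ ℝ (H m)).symm := by
  refine MvPolynomial.algHom_ext fun p => ?_
  refine (map_comulHom_coord (Algebra.TensorProduct.map (.id ℝ (H m)) (counit m)) p.1 p.2).trans ?_
  simp only [Algebra.TensorProduct.map_tmul, counit_coord, TensorProduct.tmul_zero]
  refine (congrFun (congrFun (gprod_zero (A := H m ⊗[ℝ] ℝ) _) p.1) p.2).trans ?_
  simp [coord]

/-- The antipode of `H`: the group inverse of the universal series over `H`. -/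
def antipodeHom (m : ℕ) : H m →ₐ[ℝ] H m := MvPolynomial.aeval fun p => ginv coord p.1 p.2

theorem antipodeHom_coord (i : Fin m) (η : Word m) : antipodeHom m (coord i η) = ginv coord i η := by
  simp [antipodeHom, coord]

theorem productMap_antipodeHom_id_comul :
    (Algebra.TensorProduct.productMap (antipodeHom m) (.id ℝ (H m))).comp (comulHom m) =
      (Algebra.ofId ℝ (H m)).comp (counit m) := by
  refine MvPolynomial.algHom_ext fun p => ?_
  refine (map_comulHom_coord
    (Algebra.TensorProduct.productMap (antipodeHom m) (.id ℝ (H m))) p.1 p.2).trans ?_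
  simp only [Algebra.TensorProduct.productMap_apply_tmul, map_one, mul_one, one_mul,
    antipodeHom_coord, AlgHom.id_apply]
  refine (congrFun (congrFun (ginv_gprod coord) p.1) p.2).trans ?_
  simp [counit]

theorem productMap_id_antipodeHom_comul :
    (Algebra.TensorProduct.productMap (.id ℝ (H m)) (antipodeHom m)).comp (comulHom m) =
      (Algebra.ofId ℝ (H m)).comp (counit m) := by
  refine MvPolynomial.algHom_ext fun p => ?_
  refine (map_comulHom_coord
    (Algebra.TensorProduct.productMap (.id ℝ (H m)) (antipodeHom m)) p.1 p.2).trans ?_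
  simp only [Algebra.TensorProduct.productMap_apply_tmul, map_one, mul_one, one_mul,
    antipodeHom_coord, AlgHom.id_apply]
  refine (congrFun (congrFun (gprod_ginv coord) p.1) p.2).trans ?_
  simp [counit]

/-- The Hopf algebra of the output feedback group. -/
abbrev hopfAlgebra (m : ℕ) : HopfAlgebra ℝ (H m) where
  toBialgebra := Bialgebra.ofAlgHom (comulHom m) (counit m) comulHom_coassoc comulHom_counit_left
    comulHom_counit_right
  antipode := (antipodeHom m).toLinearMap
  mul_antipode_rTensor_comul := by
    refine Eq.trans ?_ (congrArg AlgHom.toLinearMap productMap_antipodeHom_id_comul)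
    change _ = (Algebra.TensorProduct.productMap (antipodeHom m) (.id ℝ (H m))).toLinearMap ∘ₗ
      (comulHom m).toLinearMap
    rw [← LinearMap.comp_assoc]
    congr 1
    ext a b
    simp
  mul_antipode_lTensor_comul := by
    refine Eq.trans ?_ (congrArg AlgHom.toLinearMap productMap_id_antipodeHom_comul)
    change _ = (Algebra.TensorProduct.productMap (.id ℝ (H m)) (antipodeHom m)).toLinearMap ∘ₗ
      (comulHom m).toLinearMap
    rw [← LinearMap.comp_assoc]
    congr 1
    ext a b
    simp

theorem comulHom_isConnectedGradedHopfAlgebra :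
    IsConnectedGradedHopfAlgebra (grading m) (comulHom m) (counit m) where
  coassoc := comulHom_coassoc
  counit_left := comulHom_counit_left
  counit_right := comulHom_counit_right
  isInternal := grading_isInternal
  gradedMonoid := grading.gradedMonoid
  connected := grading_zero
  comul_mem n a ha := map_mem_of_mem_grading _ _ (fun i η => by
    rw [comulHom_coord]
    refine gprod_mem (fun i η => ?_) (fun i η => ?_) i η
    · exact tmul_mem_tensorGrading (l := 0) (coord_mem_grading i η) SetLike.GradedOne.one_mem
    · have := tmul_mem_tensorGrading (k := 0) (SetLike.GradedOne.one_mem (A := grading m))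
        (coord_mem_grading i η)
      rwa [zero_add] at this) ha
  counit_eq_zero _ hn _ ha := counit_eq_zero_of_mem_grading hn ha
  exists_antipode := ⟨hopfAlgebra m, rfl,
    -- The antipode is an algebra morphism, and `H` is commutative.
    fun a b => ((antipodeHom m).map_mul a b).trans (mul_comm _ _),
    fun n a ha => map_mem_of_mem_grading (grading m) (antipodeHom m) (fun i η => by
      rw [antipodeHom_coord]
      exact ginv_mem (fun i η => coord_mem_grading i η) i η) ha⟩

end HopfAlgebra

end OutputFeedback

end

theorem mainTheorem1 (m : ℕ) :
    (∃! Δ : OutputFeedback.H m →ₐ[ℝ] OutputFeedback.H m ⊗[ℝ] OutputFeedback.H m,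
      OutputFeedback.IsDualCoproduct Δ) ∧
    ∀ Δ : OutputFeedback.H m →ₐ[ℝ] OutputFeedback.H m ⊗[ℝ] OutputFeedback.H m,
      OutputFeedback.IsDualCoproduct Δ →
        OutputFeedback.IsConnectedGradedHopfAlgebra (OutputFeedback.grading m) Δ
          (OutputFeedback.counit m) := by
  refine ⟨⟨OutputFeedback.comulHom m, OutputFeedback.comulHom_isDualCoproduct,
    fun Δ hΔ => hΔ.eq_comulHom⟩, fun Δ hΔ => ?_⟩
  rw [hΔ.eq_comulHom]
  exact OutputFeedback.comulHom_isConnectedGradedHopfAlgebra
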